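/- \textbf{Theorem (Bohnenblust--Hille inequality with polynomial constant).} For positive integers $k$ and nonnegative integers $n$, let $f:(\mathbb{R}^n)^k\to\mathbb{R}$ be a $k$-linear form, that is, a map which is linear in each of its $k$ arguments. Write \[ f(x^1,\dots,x^k)=\sum_{i_1,\dots,i_k=1}^n \hat f_{i_1,\dots,i_k}\,x^1_{i_1}x^2_{i_2}\cdots x^k_{i_k} \] with (uniquely determined) real coefficients $\hat f_{i_1,\dots,i_k}$, and put \[ \|f\|_\infty := \max_{x^1,\dots,x^k\in\{\pm1\}^n}|f(x^1,\dots,x^k)|. \] There is a sequence of real constants $(C_k)_{k\ge1}$, with $C_k$ depending only on $k$, such that $C_k=O(k^{\log_2 e})$ as $k\to\infty$, and such that for all integers $k\ge1$ and $n\ge0$, every $k$-linear form $f:(\mathbb{R}^n)^k\to\mathbb{R}$, and every real $p\ge 2k/(k+1)$, \[ \Bigl(\sum_{i_1,\dots,i_k=1}^n|\hat f_{i_1,\dots,i_k}|^p\Bigr)^{1/p}\le C_k\,\|f\|_\infty . \] -/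

import Mathlib

open Asymptotics Filter

namespace BohnenblustHille

/-- A real `k`-linear form `f : (ℝⁿ)ᵏ → ℝ`. -/
abbrev Form (n k : ℕ) : Type := MultilinearMap ℝ (fun _ : Fin k => Fin n → ℝ) ℝ

/-- The coefficient `f̂ (i₁, …, iₖ) = f (e_{i₁}, …, e_{iₖ})`; `Form.eq_sum_coeff` and
`Form.coeff_unique` say that these are exactly the coefficients of the expansion of `f`. -/
def Form.coeff {n k : ℕ} (f : Form n k) (i : Fin k → Fin n) : ℝ :=
  f (fun j => Pi.single (i j) 1)

/-- `∑_{i₁, …, iₖ} |f̂ (i₁, …, iₖ)| ^ p`, raised to the power `1 / p`. -/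
noncomputable def Form.coeffNorm {n k : ℕ} (p : ℝ) (f : Form n k) : ℝ :=
  (∑ i : Fin k → Fin n, |f.coeff i| ^ p) ^ (1 / p)

/-- The point of `(ℝⁿ)ᵏ` given by a choice of `k` sign vectors of length `n`
(`ℤˣ` is the two-element type `{1, -1}`). -/
def signPoint {n k : ℕ} (ε : Fin k → Fin n → ℤˣ) : Fin k → Fin n → ℝ :=
  fun j l => ((ε j l : ℤ) : ℝ)

/-- `‖f‖_∞`: the maximum of `|f (x¹, …, xᵏ)|` over `x¹, …, xᵏ ∈ {±1}ⁿ`. -/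
noncomputable def Form.cubeNorm {n k : ℕ} (f : Form n k) : ℝ :=
  (Finset.univ : Finset (Fin k → Fin n → ℤˣ)).sup' Finset.univ_nonempty
    (fun ε => |f (signPoint ε)|)

theorem Form.eq_sum_coeff {n k : ℕ} (f : Form n k) (x : Fin k → Fin n → ℝ) :
    f x = ∑ i : Fin k → Fin n, f.coeff i * ∏ j, x j (i j) := by
  have hx : x = fun j => ∑ l : Fin n, x j l • (Pi.single l 1 : Fin n → ℝ) := by
    funext j
    exact pi_eq_sum_univ' (x j)
  conv_lhs => rw [hx]
  rw [MultilinearMap.map_sum]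
  refine Finset.sum_congr rfl fun i _ => ?_
  rw [MultilinearMap.map_smul_univ, smul_eq_mul, mul_comm]
  rfl

theorem Form.coeff_unique {n k : ℕ} (f : Form n k) (a : (Fin k → Fin n) → ℝ)
    (h : ∀ x : Fin k → Fin n → ℝ, f x = ∑ i : Fin k → Fin n, a i * ∏ j, x j (i j)) :
    a = f.coeff := by
  funext i
  rw [Form.coeff, h, Finset.sum_eq_single i]
  · simp
  · intro b _ hb
    obtain ⟨j, hj⟩ := Function.ne_iff.mp hb
    rw [Finset.prod_eq_zero (Finset.mem_univ j), mul_zero]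
    simp [hj]
  · simp

theorem Form.isGreatest_cubeNorm {n k : ℕ} (f : Form n k) :
    IsGreatest {r : ℝ | ∃ x : Fin k → Fin n → ℝ,
      (∀ j l, x j l = 1 ∨ x j l = -1) ∧ r = |f x|} f.cubeNorm := by
  constructor
  · obtain ⟨ε, -, hε⟩ := Finset.exists_mem_eq_sup' (Finset.univ_nonempty)
      (fun ε : Fin k → Fin n → ℤˣ => |f (signPoint ε)|)
    refine ⟨signPoint ε, fun j l => ?_, hε⟩
    rcases Int.units_eq_one_or (ε j l) with h | h <;> simp [signPoint, h]
  · rintro r ⟨x, hx, rfl⟩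
    have : x = signPoint (fun j l => if x j l = 1 then 1 else -1) := by
      funext j l
      rcases hx j l with h | h
      · simp [signPoint, h]
      · have h' : ¬ ((-1 : ℝ) = 1) := by norm_num
        simp [signPoint, h, h']
    rw [this]
    exact Finset.le_sup' (fun ε : Fin k → Fin n → ℤˣ => |f (signPoint ε)|) (Finset.mem_univ _)

end BohnenblustHille

/-! Induction by halving the degree. Write `k = s + t` with nearly equal halves and view the
coefficients as a matrix indexed by the two blocks. Fixing signs in one block leaves a form of lower
degree with the same sup bound; averaging over those signs, Khinchine's inequality turns the
inductive bound into a mixed norm with inner exponent 2 (`sum_sum_sq_rpow_le`). Doing this for both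
blocks and interpolating with `blei_inequality` yields exponent `2k/(k+1)`. The Khinchine constants
`3 ^ (t/(2s))` and `3 ^ (s/(2t))` combine to exactly `√3` per halving, so `C k = √3 ^ Nat.clog 2 k`
works, and `√3 ≤ e` gives the growth rate. -/

namespace BohnenblustHille

open Finset
open scoped BigOperators

/-! ### Inequalities between norms and between moments. -/

/-- Hölder's inequality in geometric-mean form. -/
theorem sum_rpow_mul_rpow_le {ι : Type*} (s : Finset ι) {f g : ι → ℝ} (hf : ∀ i, 0 ≤ f i)
    (hg : ∀ i, 0 ≤ g i) {u v : ℝ} (hu : 0 < u) (hv : 0 < v) (huv : u + v = 1) :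
    ∑ i ∈ s, f i ^ u * g i ^ v ≤ (∑ i ∈ s, f i) ^ u * (∑ i ∈ s, g i) ^ v := by
  have h := Real.inner_le_Lp_mul_Lq_of_nonneg s (Real.HolderConjugate.inv_inv hu hv huv)
    (f := fun i => f i ^ u) (g := fun i => g i ^ v)
    (fun i _ => Real.rpow_nonneg (hf i) _) (fun i _ => Real.rpow_nonneg (hg i) _)
  simpa [Real.rpow_rpow_inv (hf _) hu.ne', Real.rpow_rpow_inv (hg _) hv.ne'] using h

/-- Minkowski's inequality for a finite sum of nonnegative functions. -/
theorem sum_rpow_sum_rpow_inv_le {α β : Type*} (s : Finset α) (t : Finset β) {f : α → β → ℝ}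
    (hf : ∀ i j, 0 ≤ f i j) {r : ℝ} (hr : 1 ≤ r) :
    (∑ i ∈ s, (∑ j ∈ t, f i j) ^ r) ^ (1 / r) ≤ ∑ j ∈ t, (∑ i ∈ s, f i j ^ r) ^ (1 / r) := by
  classical
  have hr0 : r ≠ 0 := by positivity
  induction t using Finset.induction_on with
  | empty => simp [Real.zero_rpow hr0, Real.zero_rpow (inv_ne_zero hr0)]
  | insert j t hj ih =>
    simp only [sum_insert hj]
    refine (Real.Lp_add_le_of_nonneg (s := s) hr (fun i _ => hf i j)
      (fun i _ => sum_nonneg fun j _ => hf i j)).trans ?_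
    gcongr

/-- Blei's inequality: interpolation between two mixed norms of a nonnegative matrix. -/
theorem blei_inequality {α β : Type*} [Fintype α] [Fintype β] {a : α → β → ℝ}
    (ha : ∀ i j, 0 ≤ a i j) {A B l m p u v : ℝ} (hA : 0 ≤ A) (hB : 0 ≤ B)
    (hl : 0 < l) (hm : 0 < m) (hm2 : m ≤ 2) (hu : 0 < u) (hv : 0 < v)
    (h₁ : u / l + v / 2 = 1) (h₂ : u / 2 + v / m = 1) (hp : u + v = p)
    (hrow : ∑ i, (∑ j, a i j ^ (2 : ℝ)) ^ (l / 2) ≤ A ^ l)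
    (hcol : ∑ j, (∑ i, a i j ^ (2 : ℝ)) ^ (m / 2) ≤ B ^ m) :
    ∑ i, ∑ j, a i j ^ p ≤ A ^ u * B ^ v := by
  have hX : ∀ i, 0 ≤ ∑ j, a i j ^ (2 : ℝ) :=
    fun i => sum_nonneg fun j _ => Real.rpow_nonneg (ha i j) _
  have hY : ∀ i, 0 ≤ ∑ j, a i j ^ m :=
    fun i => sum_nonneg fun j _ => Real.rpow_nonneg (ha i j) _
  -- Since `2 / m ≥ 1`, Minkowski exchanges the order of summation, so that `i` is the outer index
  -- in both mixed norms.
  have hmink : ∑ i, (∑ j, a i j ^ m) ^ (2 / m) ≤ B ^ (2 : ℝ) := by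
    have h := sum_rpow_sum_rpow_inv_le univ univ (f := fun i j => a i j ^ m)
      (fun i j => Real.rpow_nonneg (ha i j) _) (r := 2 / m) (by rwa [le_div_iff₀ hm, one_mul])
    have e : ∀ i j, (a i j ^ m) ^ (2 / m) = a i j ^ (2 : ℝ) := fun i j => by
      rw [← Real.rpow_mul (ha i j), mul_div_cancel₀ _ hm.ne']
    simp only [e, one_div_div] at h
    have h' := Real.rpow_le_rpow (Real.rpow_nonneg (sum_nonneg fun i _ =>
      Real.rpow_nonneg (hY i) _) _) (h.trans hcol) (z := 2 / m) (by positivity)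
    rwa [← Real.rpow_mul (sum_nonneg fun i _ => Real.rpow_nonneg (hY i) _),
      ← Real.rpow_mul hB, mul_div_cancel₀ _ hm.ne', div_mul_div_cancel₀ two_ne_zero,
      div_self hm.ne', Real.rpow_one] at h'
  -- Hölder is applied twice: in `j` with weights `u/2`, `v/m`, then in `i` with weights `u/l`,
  -- `v/2`.
  have hinner : ∀ i, ∑ j, a i j ^ p ≤
      (∑ j, a i j ^ (2 : ℝ)) ^ (u / 2) * (∑ j, a i j ^ m) ^ (v / m) := fun i => by
    refine le_trans (le_of_eq (sum_congr rfl fun j _ => ?_)) (sum_rpow_mul_rpow_le univ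
      (f := fun j => a i j ^ (2 : ℝ)) (g := fun j => a i j ^ m)
      (fun j => Real.rpow_nonneg (ha i j) _) (fun j => Real.rpow_nonneg (ha i j) _)
      (u := u / 2) (v := v / m) (by positivity) (by positivity) h₂)
    rw [← Real.rpow_mul (ha i j), ← Real.rpow_mul (ha i j), mul_div_cancel₀ _ hm.ne',
      mul_div_cancel₀ _ two_ne_zero, ← Real.rpow_add_of_nonneg (ha i j) hu.le hv.le, hp]
  have houter := sum_rpow_mul_rpow_le univ
      (f := fun i => (∑ j, a i j ^ (2 : ℝ)) ^ (l / 2)) (g := fun i => (∑ j, a i j ^ m) ^ (2 / m))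
      (fun i => Real.rpow_nonneg (hX i) _) (fun i => Real.rpow_nonneg (hY i) _)
      (u := u / l) (v := v / 2) (by positivity) (by positivity) h₁
  have e₁ : ∀ i, ((∑ j, a i j ^ (2 : ℝ)) ^ (l / 2)) ^ (u / l)
      = (∑ j, a i j ^ (2 : ℝ)) ^ (u / 2) := fun i => by
    rw [← Real.rpow_mul (hX i)]; congr 1; field_simp
  have e₂ : ∀ i, ((∑ j, a i j ^ m) ^ (2 / m)) ^ (v / 2) = (∑ j, a i j ^ m) ^ (v / m) := fun i => by
    rw [← Real.rpow_mul (hY i)]; congr 1; field_simp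
  simp only [e₁, e₂] at houter
  calc ∑ i, ∑ j, a i j ^ p
      ≤ _ := sum_le_sum fun i _ => hinner i
    _ ≤ _ := houter
    _ ≤ (A ^ l) ^ (u / l) * (B ^ (2 : ℝ)) ^ (v / 2) := by
      gcongr
      · exact Real.rpow_nonneg (sum_nonneg fun i _ => Real.rpow_nonneg (hY i) _) _
      · exact sum_nonneg fun i _ => Real.rpow_nonneg (hX i) _
      · exact sum_nonneg fun i _ => Real.rpow_nonneg (hY i) _
    _ = A ^ u * B ^ v := by
      rw [← Real.rpow_mul hA, ← Real.rpow_mul hB, mul_div_cancel₀ _ hl.ne',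
        mul_div_cancel₀ _ two_ne_zero]

/-- The `ℓ^p` norms of a finite family decrease in `p`. -/
theorem sum_rpow_rpow_inv_antitone {ι : Type*} [Fintype ι] {f : ι → ℝ} (hf : ∀ i, 0 ≤ f i)
    {p q : ℝ} (hq : 0 < q) (hqp : q ≤ p) :
    (∑ i, f i ^ p) ^ (1 / p) ≤ (∑ i, f i ^ q) ^ (1 / q) := by
  have hp : 0 < p := hq.trans_le hqp
  set S := ∑ i, f i ^ q with hS
  have hS0 : 0 ≤ S := sum_nonneg fun i _ => Real.rpow_nonneg (hf i) _
  have hle : ∀ i, f i ≤ S ^ (1 / q) := fun i => by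
    have h := single_le_sum (f := fun i => f i ^ q)
      (fun i _ => Real.rpow_nonneg (hf i) _) (mem_univ i)
    have h' := Real.rpow_le_rpow (Real.rpow_nonneg (hf i) _) h (z := 1 / q) (by positivity)
    rwa [← Real.rpow_mul (hf i), mul_one_div_cancel hq.ne', Real.rpow_one] at h'
  have key : ∑ i, f i ^ p ≤ S ^ (p / q) := by
    calc ∑ i, f i ^ p = ∑ i, f i ^ q * f i ^ (p - q) := sum_congr rfl fun i _ => by
          rw [← Real.rpow_add_of_nonneg (hf i) hq.le (by linarith)]; congr 1; ring
      _ ≤ ∑ i, f i ^ q * (S ^ (1 / q)) ^ (p - q) := sum_le_sum fun i _ =>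
          mul_le_mul_of_nonneg_left (Real.rpow_le_rpow (hf i) (hle i) (by linarith))
            (Real.rpow_nonneg (hf i) _)
      _ = S ^ (p / q) := by
          rw [← sum_mul, ← hS, ← Real.rpow_mul hS0]
          nth_rewrite 1 [← Real.rpow_one S]
          rw [← Real.rpow_add_of_nonneg hS0 zero_le_one
            (mul_nonneg (by positivity) (by linarith))]
          congr 1; field_simp; ring
  have h := Real.rpow_le_rpow (sum_nonneg fun i _ => Real.rpow_nonneg (hf i) _) key
    (z := 1 / p) (by positivity)
  rwa [← Real.rpow_mul hS0, div_mul_div_comm, mul_one, mul_comm q p, ← div_div, div_self hp.ne']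
    at h

/-- If the fourth moment of `g` is at most `K` times the square of its second moment, then the
second moment is controlled by any moment of order `p < 2`. -/
theorem rpow_expect_sq_le {Ω : Type*} [Fintype Ω] [Nonempty Ω] (g : Ω → ℝ) {K p : ℝ}
    (hK : 0 ≤ K) (hp : 0 < p) (hp2 : p < 2)
    (h : 𝔼 x, g x ^ 4 ≤ K * (𝔼 x, g x ^ 2) ^ 2) :
    (𝔼 x, g x ^ 2) ^ (p / 2) ≤ K ^ ((2 - p) / 2) * 𝔼 x, |g x| ^ p := by
  set σ := 𝔼 x, g x ^ 2 with hσ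
  have hσ0 : 0 ≤ σ := expect_nonneg fun x _ => sq_nonneg _
  set X := 𝔼 x, |g x| ^ p with hX
  have hX0 : 0 ≤ X := expect_nonneg fun x _ => Real.rpow_nonneg (abs_nonneg _) _
  have h4 : 0 < 4 - p := by linarith
  have hs : 2 / (4 - p) + (2 - p) / (4 - p) = 1 := by field_simp; ring
  have hs0 : 0 < 2 / (4 - p) := by positivity
  have ht0 : 0 < (2 - p) / (4 - p) := div_pos (by linarith) h4
  -- The exponent 2 is interpolated between `p` and 4; the weights solve `p * θ + 4 * (1 - θ) = 2`.
  have holder : σ ≤ X ^ (2 / (4 - p)) * (𝔼 x, g x ^ 4) ^ ((2 - p) / (4 - p)) := by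
    have hsum := sum_rpow_mul_rpow_le univ (f := fun x => |g x| ^ p) (g := fun x => g x ^ 4)
      (fun x => Real.rpow_nonneg (abs_nonneg _) _) (fun x => by positivity) hs0 ht0 hs
    have e : ∀ x, (|g x| ^ p) ^ (2 / (4 - p)) * (g x ^ 4) ^ ((2 - p) / (4 - p)) = g x ^ 2 :=
      fun x => by
        have : g x ^ 4 = |g x| ^ (4 : ℝ) := by
          rw [← Even.pow_abs (by decide : Even 4)]; norm_cast
        rw [this, ← Real.rpow_mul (abs_nonneg _), ← Real.rpow_mul (abs_nonneg _),
          ← Real.rpow_add_of_nonneg (abs_nonneg _) (by positivity) (by positivity)]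
        have : p * (2 / (4 - p)) + 4 * ((2 - p) / (4 - p)) = 2 := by field_simp; ring
        rw [this]; norm_cast; exact sq_abs _
    simp only [e] at hsum
    have hN : (0 : ℝ) < Fintype.card Ω := by exact_mod_cast Fintype.card_pos
    rw [hσ, hX]
    simp only [Fintype.expect_eq_sum_div_card]
    rw [Real.div_rpow (sum_nonneg fun x _ => Real.rpow_nonneg (abs_nonneg _) _) hN.le,
      Real.div_rpow (sum_nonneg fun x _ => by positivity) hN.le, div_mul_div_comm,
      ← Real.rpow_add hN, hs, Real.rpow_one]
    gcongr
  -- A power of `σ` is cancelled below, so `σ = 0` is treated apart.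
  rcases hσ0.eq_or_lt with h0 | h0
  · rw [← h0, Real.zero_rpow (by positivity)]; positivity
  have h2 : σ ≤ X ^ (2 / (4 - p)) *
      (K ^ ((2 - p) / (4 - p)) * σ ^ (2 * ((2 - p) / (4 - p)))) := by
    refine holder.trans ?_
    rw [Real.rpow_mul hσ0, Real.rpow_two, ← Real.mul_rpow hK (by positivity)]
    gcongr
  have h3 : σ ^ (p / (4 - p)) ≤ X ^ (2 / (4 - p)) * K ^ ((2 - p) / (4 - p)) := by
    have hpos : 0 < σ ^ (2 * ((2 - p) / (4 - p))) := Real.rpow_pos_of_pos h0 _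
    refine le_of_mul_le_mul_right ?_ hpos
    rw [← Real.rpow_add h0, mul_assoc]
    have : p / (4 - p) + 2 * ((2 - p) / (4 - p)) = 1 := by field_simp; ring
    rw [this, Real.rpow_one]
    exact h2
  have h5 := Real.rpow_le_rpow (Real.rpow_nonneg hσ0 _) h3 (z := (4 - p) / 2) (by positivity)
  rw [Real.mul_rpow (by positivity) (by positivity), ← Real.rpow_mul hσ0, ← Real.rpow_mul hX0,
    ← Real.rpow_mul hK, div_mul_div_cancel₀ h4.ne', div_mul_div_cancel₀ h4.ne',
    div_mul_div_cancel₀ h4.ne', div_self two_ne_zero, Real.rpow_one] at h5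
  rw [mul_comm]; exact h5

/-! ### Moments of multilinear forms in random signs. -/

/-- The value at `ε` of the multilinear form with coefficients `a`. -/
noncomputable def signSum {n k : ℕ} (a : (Fin k → Fin n) → ℝ) (ε : Fin k → Fin n → ℤˣ) : ℝ :=
  ∑ i, a i * ∏ j, ((ε j (i j) : ℤ) : ℝ)

theorem signSum_cons {n k : ℕ} (a : (Fin (k + 1) → Fin n) → ℝ) (x : Fin n → ℤˣ)
    (ε : Fin k → Fin n → ℤˣ) :
    signSum a (Fin.cons x ε : Fin (k + 1) → Fin n → ℤˣ) =
      ∑ l, ((x l : ℤ) : ℝ) * signSum (fun i => a (Fin.cons l i)) ε := by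
  unfold signSum
  rw [← Fintype.sum_equiv (Fin.consEquiv fun _ => Fin n) (fun q => a (Fin.cons q.1 q.2) *
    (((x q.1 : ℤ) : ℝ) * ∏ j, ((ε j (q.2 j) : ℤ) : ℝ))) _ fun q => by
      simp [Fin.consEquiv, Fin.prod_univ_succ], Fintype.sum_prod_type]
  refine sum_congr rfl fun l _ => ?_
  rw [mul_sum]
  exact sum_congr rfl fun i _ => by ring

theorem signSum_append {n k l : ℕ} (a : (Fin (k + l) → Fin n) → ℝ) (ε : Fin k → Fin n → ℤˣ)
    (δ : Fin l → Fin n → ℤˣ) :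
    signSum a (Fin.append ε δ) =
      signSum (fun i => signSum (fun j => a (Fin.append i j)) δ) ε := by
  unfold signSum
  rw [← Fintype.sum_equiv (Fin.appendEquiv k l) (fun q => a (Fin.append q.1 q.2) *
    ((∏ j, ((ε j (q.1 j) : ℤ) : ℝ)) * ∏ j, ((δ j (q.2 j) : ℤ) : ℝ))) _ fun q => by
      simp [Fin.appendEquiv, Fin.prod_univ_add], Fintype.sum_prod_type]
  refine sum_congr rfl fun i _ => ?_
  rw [sum_mul]
  exact sum_congr rfl fun j _ => by ring

theorem expect_fin_succ {α : Type*} [Fintype α] [DecidableEq α] {k : ℕ}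
    (F : (Fin (k + 1) → α) → ℝ) :
    𝔼 ε, F ε = 𝔼 x : α, 𝔼 ε : Fin k → α, F (Fin.cons x ε) := by
  rw [← Fintype.expect_equiv (Fin.consEquiv fun _ => α) (fun q => F (Fin.cons q.1 q.2)) F
    fun q => rfl, ← univ_product_univ, expect_product]

theorem expect_units (F : ℤˣ → ℝ) : 𝔼 s, F s = (F 1 + F (-1)) / 2 := by
  rw [Fintype.expect_eq_sum_div_card]
  have : (univ : Finset ℤˣ) = {1, -1} := rfl
  simp [this]

theorem expect_sum_sign_sq {n : ℕ} (v : Fin n → ℝ) :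
    𝔼 x : Fin n → ℤˣ, (∑ l, ((x l : ℤ) : ℝ) * v l) ^ 2 = ∑ l, v l ^ 2 := by
  induction n with
  | zero => simp
  | succ n ih =>
    rw [expect_fin_succ, expect_comm, Fin.sum_univ_succ, ← ih]
    simp only [Fin.sum_univ_succ, Fin.cons_zero, Fin.cons_succ, expect_units]
    rw [← Fintype.expect_const (ι := Fin n → ℤˣ) (v 0 ^ 2), ← expect_add_distrib]
    refine expect_congr rfl fun x _ => ?_
    push_cast
    ring

theorem expect_sum_sign_pow_four_le {n : ℕ} (v : Fin n → ℝ) :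
    𝔼 x : Fin n → ℤˣ, (∑ l, ((x l : ℤ) : ℝ) * v l) ^ 4 ≤ 3 * (∑ l, v l ^ 2) ^ 2 := by
  induction n with
  | zero => simp
  | succ n ih =>
    have ih := ih fun l => v l.succ
    have h2 := expect_sum_sign_sq fun l => v (Fin.succ l)
    rw [expect_fin_succ, expect_comm]
    simp only [Fin.sum_univ_succ, Fin.cons_zero, Fin.cons_succ, expect_units]
    have e : ∀ S : ℝ, (((((1 : ℤˣ) : ℤ) : ℝ) * v 0 + S) ^ 4 +
        ((((-1 : ℤˣ) : ℤ) : ℝ) * v 0 + S) ^ 4) / 2 = S ^ 4 + 6 * v 0 ^ 2 * S ^ 2 + v 0 ^ 4 := by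
      intro S; push_cast; ring
    simp only [e, expect_add_distrib, ← mul_expect, Fintype.expect_const, h2]
    -- With `s` the sum of the remaining squares, `3s² + 6v₀²s + v₀⁴ ≤ 3(s + v₀²)²`.
    nlinarith [sq_nonneg (v 0 ^ 2)]

theorem expect_signSum_sq {n k : ℕ} (a : (Fin k → Fin n) → ℝ) :
    𝔼 ε, signSum a ε ^ 2 = ∑ i, a i ^ 2 := by
  induction k with
  | zero => simp [signSum]
  | succ k ih =>
    rw [expect_fin_succ, expect_comm]
    simp only [signSum_cons, expect_sum_sign_sq]
    rw [expect_sum_comm]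
    simp only [ih]
    rw [← Fintype.sum_prod_type']
    exact Fintype.sum_equiv (Fin.consEquiv fun _ => Fin n) _ _ fun q => rfl

/-- Each argument costs a factor 3: the linear case is used in the first argument with the others
frozen, and Cauchy–Schwarz reduces the resulting cross terms to fourth moments of forms of lower
degree. -/
theorem expect_signSum_pow_four_le {n k : ℕ} (a : (Fin k → Fin n) → ℝ) :
    𝔼 ε, signSum a ε ^ 4 ≤ 3 ^ k * (∑ i, a i ^ 2) ^ 2 := by
  induction k with
  | zero => simp [signSum, ← pow_mul]
  | succ k ih =>
    rw [expect_fin_succ, expect_comm]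
    simp only [signSum_cons]
    set G : Fin n → (Fin k → Fin n → ℤˣ) → ℝ := fun l => signSum fun i => a (Fin.cons l i)
    set S : Fin n → ℝ := fun l => ∑ i : Fin k → Fin n, a (Fin.cons l i) ^ 2
    have hS : ∀ l, 0 ≤ S l := fun l => sum_nonneg fun i _ => sq_nonneg _
    have hcs : ∀ l m, 𝔼 ε, G l ε ^ 2 * G m ε ^ 2 ≤ 3 ^ k * (S l * S m) := fun l m => by
      have hlm := mul_nonneg (hS l) (hS m)
      refine le_of_sq_le_sq ?_ (by positivity)
      refine (expect_mul_sq_le_sq_mul_sq univ (fun ε => G l ε ^ 2) (fun ε => G m ε ^ 2)).trans ?_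
      simp only [← pow_mul]
      calc (𝔼 ε, G l ε ^ 4) * 𝔼 ε, G m ε ^ 4
          ≤ (3 ^ k * S l ^ 2) * (3 ^ k * S m ^ 2) := by
            refine mul_le_mul (ih _) (ih _) (expect_nonneg fun ε _ => by positivity)
              (by positivity)
        _ = _ := by ring
    have hsum : ∑ i, a i ^ 2 = ∑ l, S l := by
      rw [← Fintype.sum_prod_type']
      exact (Fintype.sum_equiv (Fin.consEquiv fun _ => Fin n) _ _ fun q => rfl).symm
    calc 𝔼 ε, 𝔼 x : Fin n → ℤˣ, (∑ l, ((x l : ℤ) : ℝ) * G l ε) ^ 4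
        ≤ 𝔼 ε, 3 * (∑ l, G l ε ^ 2) ^ 2 :=
          expect_le_expect fun ε _ => expect_sum_sign_pow_four_le _
      _ = 3 * ∑ l, ∑ m, 𝔼 ε, G l ε ^ 2 * G m ε ^ 2 := by
          rw [← mul_expect]
          simp only [sq (∑ l, _), sum_mul_sum, expect_sum_comm]
      _ ≤ 3 * ∑ l, ∑ m, 3 ^ k * (S l * S m) := by
          gcongr with l _ m _
          exact hcs l m
      _ = _ := by
          rw [hsum, sq, sum_mul_sum, pow_succ]
          simp only [← mul_sum]
          ring

/-! ### The halving induction. -/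

theorem signSum_comm {n s t : ℕ} (a : (Fin s → Fin n) → (Fin t → Fin n) → ℝ)
    (ε : Fin s → Fin n → ℤˣ) (δ : Fin t → Fin n → ℤˣ) :
    signSum (fun i => signSum (a i) δ) ε = signSum (fun j => signSum (fun i => a i j) ε) δ := by
  simp only [signSum, sum_mul]
  rw [sum_comm]
  exact sum_congr rfl fun j _ => sum_congr rfl fun i _ => by ring

/-- A bound for `s`-linear forms passes to a mixed `ℓ^(2s/(s+1))(ℓ²)` bound for `(s+t)`-linear
forms, by Khinchine's inequality in the last `t` arguments. -/
theorem sum_sum_sq_rpow_le {n s t : ℕ} (hs : 1 ≤ s) {D M : ℝ} (hD : 0 ≤ D)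
    (hbound : ∀ c : (Fin s → Fin n) → ℝ, (∀ ε, |signSum c ε| ≤ M) →
      ∑ i, |c i| ^ (2 * (s : ℝ) / (s + 1)) ≤ D ^ (2 * (s : ℝ) / (s + 1)))
    (a : (Fin s → Fin n) → (Fin t → Fin n) → ℝ)
    (hM : ∀ ε δ, |signSum (fun i => signSum (a i) δ) ε| ≤ M) :
    ∑ i, (∑ j, |a i j| ^ (2 : ℝ)) ^ (2 * (s : ℝ) / (s + 1) / 2) ≤
      ((3 : ℝ) ^ ((t : ℝ) / (2 * s)) * D) ^ (2 * (s : ℝ) / (s + 1)) := by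
  have hs0 : (0 : ℝ) < s := by exact_mod_cast hs
  set l : ℝ := 2 * (s : ℝ) / (s + 1) with hl
  have hl0 : 0 < l := by positivity
  have hl2 : l < 2 := by rw [hl, div_lt_iff₀ (by positivity)]; linarith
  have hkh : ∀ i, (∑ j, |a i j| ^ (2 : ℝ)) ^ (l / 2) ≤
      ((3 : ℝ) ^ t) ^ ((2 - l) / 2) * 𝔼 δ, |signSum (a i) δ| ^ l := fun i => by
    have h := rpow_expect_sq_le (signSum (a i)) (K := 3 ^ t) (by positivity) hl0 hl2
      (by rw [expect_signSum_sq]; exact expect_signSum_pow_four_le _)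
    rw [expect_signSum_sq] at h
    simpa using h
  calc ∑ i, (∑ j, |a i j| ^ (2 : ℝ)) ^ (l / 2)
      ≤ ∑ i, ((3 : ℝ) ^ t) ^ ((2 - l) / 2) * 𝔼 δ, |signSum (a i) δ| ^ l :=
        sum_le_sum fun i _ => hkh i
    _ = ((3 : ℝ) ^ t) ^ ((2 - l) / 2) * 𝔼 δ, ∑ i, |signSum (a i) δ| ^ l := by
        rw [← mul_sum, expect_sum_comm]
    _ ≤ ((3 : ℝ) ^ t) ^ ((2 - l) / 2) * D ^ l := by
        gcongr
        -- For each fixed `δ`, the form in `ε` is still bounded by `M`, so `hbound` applies before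
        -- averaging.
        exact expect_le univ_nonempty fun δ _ => hbound _ fun ε => hM ε δ
    _ = _ := by
        rw [Real.mul_rpow (by positivity) hD, ← Real.rpow_natCast 3 t,
          ← Real.rpow_mul (by norm_num), ← Real.rpow_mul (by norm_num)]
        congr 2
        rw [hl]
        field_simp
        ring

/-- The exponent of `√3` counts how often `k` must be halved, rounding up, to reach 1. -/
theorem sum_abs_rpow_le_of_signSum_le {k : ℕ} (hk : 1 ≤ k) {n : ℕ} (a : (Fin k → Fin n) → ℝ)
    {M : ℝ} (hM : ∀ ε, |signSum a ε| ≤ M) :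
    ∑ i, |a i| ^ (2 * (k : ℝ) / (k + 1)) ≤
      (√3 ^ Nat.clog 2 k * M) ^ (2 * (k : ℝ) / (k + 1)) := by
  have hM0 : 0 ≤ M := (abs_nonneg _).trans (hM 1)
  induction k using Nat.strong_induction_on with
  | _ k ih =>
  rcases hk.eq_or_lt with rfl | hk2
  -- For `k = 1` the exponent is 1, and choosing the signs of the coefficients attains their
  -- absolute sum.
  · have h := (le_abs_self _).trans (hM fun _ l => if 0 ≤ a (fun _ => l) then 1 else -1)
    norm_num
    refine le_trans (le_of_eq (sum_congr rfl fun i _ => ?_)) h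
    have hi : (fun _ => i 0) = i := funext fun j => by rw [Subsingleton.elim j 0]
    simp only [univ_unique, Fin.default_eq_zero, prod_singleton, hi]
    split_ifs with h0
    · simp [abs_of_nonneg h0]
    · simp [abs_of_neg (not_le.mp h0)]
  · obtain ⟨s, t, rfl, hs, ht, hst, hc⟩ : ∃ s t, k = s + t ∧ 1 ≤ s ∧ 1 ≤ t ∧ s ≤ t ∧
        Nat.clog 2 k = Nat.clog 2 t + 1 := by
      refine ⟨k / 2, (k + 1) / 2, by omega, by omega, by omega, by omega, ?_⟩
      rw [Nat.clog_of_two_le one_lt_two hk2]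
      rfl
    have hs0 : (0 : ℝ) < s := by exact_mod_cast hs
    have ht0 : (0 : ℝ) < t := by exact_mod_cast ht
    -- The larger half `t` gives a constant valid for both blocks.
    set D := √3 ^ Nat.clog 2 t * M with hD
    have hD0 : 0 ≤ D := by positivity
    have hsD : √3 ^ Nat.clog 2 s * M ≤ D := by
      rw [hD]
      gcongr
      · exact Real.one_le_sqrt.mpr (by norm_num)
    have hM' : ∀ (ε : Fin s → Fin n → ℤˣ) (δ : Fin t → Fin n → ℤˣ),
        |signSum (fun i => signSum (fun j => a (Fin.append i j)) δ) ε| ≤ M := fun ε δ => by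
      rw [← signSum_append]
      exact hM _
    have hrow := sum_sum_sq_rpow_le hs hD0 (M := M)
      (fun c hc => (ih s (by omega) hs c hc).trans (by gcongr))
      (fun i j => a (Fin.append i j)) hM'
    have hcol := sum_sum_sq_rpow_le ht hD0 (M := M)
      (fun c hc => ih t (by omega) ht c hc)
      (fun j i => a (Fin.append i j)) (fun δ ε => by rw [signSum_comm]; exact hM' ε δ)
    have h := blei_inequality (a := fun i j => |a (Fin.append i j)|) (fun i j => abs_nonneg _)
      (p := 2 * ((s : ℝ) + t) / (s + t + 1)) (u := 2 * (s : ℝ) / (s + t + 1))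
      (v := 2 * (t : ℝ) / (s + t + 1))
      (by positivity) (by positivity) (by positivity) (by positivity)
      (by rw [div_le_iff₀ (by positivity)]; linarith) (by positivity) (by positivity)
      (by field_simp; ring) (by field_simp; ring) (by ring) hrow hcol
    rw [← Fintype.sum_equiv (Fin.appendEquiv s t) (fun q => |a (Fin.append q.1 q.2)| ^
      (2 * ((s + t : ℕ) : ℝ) / ((s + t : ℕ) + 1))) _ fun q => rfl, Fintype.sum_prod_type, hc]
    push_cast
    refine h.trans (le_of_eq ?_)
    have e : √3 ^ (Nat.clog 2 t + 1) * M = (3 : ℝ) ^ (1 / 2 : ℝ) * D := by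
      rw [hD, ← Real.sqrt_eq_rpow]; ring
    rw [e, Real.mul_rpow (by positivity) hD0, Real.mul_rpow (by positivity) hD0,
      Real.mul_rpow (by positivity) hD0, mul_mul_mul_comm, ← Real.rpow_add_of_nonneg hD0
      (by positivity) (by positivity), ← Real.rpow_mul (by norm_num),
      ← Real.rpow_mul (by norm_num), ← Real.rpow_mul (by norm_num),
      ← Real.rpow_add (by norm_num)]
    congr 2
    -- The exponents of 3 add up to `(t + s) / (s + t + 1)`, half of the target exponent: one factor
    -- `√3`.
    · field_simp; ring
    · ring

/-! ### Transfer to `Form` and growth of the constant. -/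

theorem Form.apply_signPoint {n k : ℕ} (f : Form n k) (ε : Fin k → Fin n → ℤˣ) :
    f (signPoint ε) = signSum f.coeff ε :=
  f.eq_sum_coeff _

theorem Form.coeffNorm_le {k : ℕ} (hk : 1 ≤ k) {n : ℕ} (f : Form n k) {p : ℝ}
    (hp : 2 * (k : ℝ) / (k + 1) ≤ p) : f.coeffNorm p ≤ √3 ^ Nat.clog 2 k * f.cubeNorm := by
  have hk0 : (0 : ℝ) < k := by exact_mod_cast hk
  have hM : ∀ ε, |signSum f.coeff ε| ≤ f.cubeNorm := fun ε => by
    rw [← f.apply_signPoint]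
    exact le_sup' (fun ε => |f (signPoint ε)|) (mem_univ ε)
  have hM0 : 0 ≤ f.cubeNorm := (abs_nonneg _).trans (hM 1)
  have hq : 0 < 2 * (k : ℝ) / (k + 1) := by positivity
  refine (sum_rpow_rpow_inv_antitone (fun i => abs_nonneg (f.coeff i)) hq hp).trans ?_
  refine (Real.rpow_le_rpow (sum_nonneg fun i _ => Real.rpow_nonneg (abs_nonneg _) _)
    (sum_abs_rpow_le_of_signSum_le hk f.coeff hM) (by positivity)).trans (le_of_eq ?_)
  rw [one_div, Real.rpow_rpow_inv (by positivity) hq.ne']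

/-- Replacing `√3` by `e` is generous; the rounding in `Nat.clog 2 k ≤ 1 + log₂ k` costs the leading
factor `e`. -/
theorem sqrt_three_pow_clog_le {k : ℕ} (hk : 1 ≤ k) :
    √3 ^ Nat.clog 2 k ≤ Real.exp 1 * (k : ℝ) ^ Real.logb 2 (Real.exp 1) := by
  have hk0 : (0 : ℝ) < k := by exact_mod_cast hk
  have hbase : √3 ≤ Real.exp 1 := by
    have := Real.add_one_le_exp (1 : ℝ)
    refine Real.sqrt_le_iff.mpr ⟨by positivity, by nlinarith⟩
  have hclog : (Nat.clog 2 k : ℝ) ≤ 1 + Real.logb 2 k := by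
    rcases hk.eq_or_lt with rfl | hk2
    · simp
    · have h := (Nat.pow_pred_clog_lt_self one_lt_two hk2).le
      have hpos := Nat.clog_pos one_lt_two hk2
      have h' : (2 : ℝ) ^ ((Nat.clog 2 k).pred : ℝ) ≤ k := by
        rw [Real.rpow_natCast]; exact_mod_cast h
      have := (Real.le_logb_iff_rpow_le one_lt_two hk0).mpr h'
      have e : ((Nat.clog 2 k).pred : ℝ) + 1 = Nat.clog 2 k := by
        exact_mod_cast Nat.succ_pred_eq_of_pos hpos
      linarith
  calc √3 ^ Nat.clog 2 k ≤ Real.exp 1 ^ Nat.clog 2 k := by gcongr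
    _ = Real.exp (Nat.clog 2 k) := by rw [← Real.exp_nat_mul, mul_one]
    _ ≤ Real.exp (1 + Real.logb 2 k) := Real.exp_le_exp.mpr hclog
    _ = _ := by
      rw [Real.exp_add, Real.rpow_def_of_pos hk0, Real.logb, Real.logb, Real.log_exp]
      congr 2
      ring

end BohnenblustHille

theorem mainTheorem4 :
    ∃ C : ℕ → ℝ,
      (C =O[atTop] fun k : ℕ => (k : ℝ) ^ Real.logb 2 (Real.exp 1)) ∧
      ∀ k : ℕ, 1 ≤ k → ∀ (n : ℕ) (f : BohnenblustHille.Form n k) (p : ℝ),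
        2 * (k : ℝ) / ((k : ℝ) + 1) ≤ p →
          f.coeffNorm p ≤ C k * f.cubeNorm := by
  refine ⟨fun k => √3 ^ Nat.clog 2 k, ?_, fun k hk n f p hp =>
    BohnenblustHille.Form.coeffNorm_le hk f hp⟩
  refine IsBigO.of_bound (Real.exp 1) ?_
  filter_upwards [eventually_ge_atTop 1] with k hk
  rw [Real.norm_of_nonneg (by positivity), Real.norm_of_nonneg (by positivity)]
  exact BohnenblustHille.sqrt_three_pow_clog_le hk
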